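/- Let $R$ be a commutative Noetherian local ring with identity, with maximal ideal $\mathfrak m$, and suppose that $\operatorname{depth} R>0$. Then $R$ satisfies (SAC) if and only if $R$ satisfies (SACC), where (SAC) and (SACC) are the following conditions. (SAC): for every finitely generated $R$-module $M$, if $\operatorname{Ext}^i_R(M,R)=0$ for all $i>0$ and $\operatorname{Ext}^i_R(M,M)=0$ for all sufficiently large $i$, then $\operatorname{Ext}^i_R(M,M)=0$ for all $i>0$. (SACC): for every finitely generated $R$-module $M$ with constant rank, if $\operatorname{Ext}^i_R(M,R)=0$ for all $i>0$ and $\operatorname{Ext}^i_R(M,M)=0$ for all sufficiently large $i$, then $\operatorname{Ext}^i_R(M,M)=0$ for all $i>0$. Here $M$ has constant rank if there is an integer $n\ge 0$ such that $M_{\mathfrak p}\cong R_{\mathfrak p}^{\,n}$ as $R_{\mathfrak p}$-modules for every associated prime $\mathfrak p$ of $R$, and $\operatorname{depth} R$ is the supremum of the lengths of $R$-regular sequences contained in $\mathfrak m$. -/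

import Mathlib

open CategoryTheory

universe u

namespace SymmetricAuslander

/-- The depth of a local ring: the supremum of the lengths of the regular sequences on `R`
all of whose terms lie in the maximal ideal. -/
noncomputable def depth (R : Type u) [CommRing R] [IsLocalRing R] : ℕ∞ :=
  ⨆ (rs : List R) (_ : RingTheory.Sequence.IsRegular R rs)
    (_ : ∀ r ∈ rs, r ∈ IsLocalRing.maximalIdeal R), (rs.length : ℕ∞)

/-- `M` has constant rank: for some `n`, the module `M_p` is free of rank `n` over `R_p`
for every associated prime `p` of the ring `R`. -/
def HasConstantRank (R : Type u) [CommRing R] (M : Type u) [AddCommGroup M] [Module R M] : Prop :=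
  ∃ n : ℕ, ∀ (p : Ideal R) [p.IsPrime], p ∈ associatedPrimes R R →
    Nonempty (LocalizedModule p.primeCompl M ≃ₗ[Localization.AtPrime p]
      (Fin n → Localization.AtPrime p))

/-- `Ext_R^i(M, N) = 0` for all `i > n`. -/
def ExtVanishesAbove (R : Type u) [CommRing R] (n : ℕ) (M N : Type u) [AddCommGroup M]
    [Module R M] [AddCommGroup N] [Module R N] : Prop :=
  ∀ i : ℕ, n < i → Subsingleton (Abelian.Ext (ModuleCat.of R M) (ModuleCat.of R N) i)

/-- The symmetric Auslander condition (SAC). -/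
def SAC (R : Type u) [CommRing R] : Prop :=
  ∀ (M : Type u) [AddCommGroup M] [Module R M] [Module.Finite R M],
    ExtVanishesAbove R 0 M R → (∃ n : ℕ, ExtVanishesAbove R n M M) → ExtVanishesAbove R 0 M M

/-- The symmetric Auslander condition for modules with constant rank (SACC). -/
def SACC (R : Type u) [CommRing R] : Prop :=
  ∀ (M : Type u) [AddCommGroup M] [Module R M] [Module.Finite R M], HasConstantRank R M →
    ExtVanishesAbove R 0 M R → (∃ n : ℕ, ExtVanishesAbove R n M M) → ExtVanishesAbove R 0 M M

end SymmetricAuslander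

namespace CategoryTheory.ShortComplex.ShortExact

open Abelian

universe w v u'

variable {C : Type u'} [Category.{v} C] [Abelian C] [HasExt.{w} C] {S : ShortComplex C}

/-! Only (SACC) ⇒ (SAC) has content: `M` is traded for a module of constant rank without losing its
self-extensions. Positive depth gives an `R`-regular `x ∈ 𝔪`. A syzygy `N` of `M` lies in a free
module, so `x` is regular on `N`. For a free cover `F` of `N / xN`, the kernel `L` contains `xF`, so
`L` and `F` agree at the associated primes and `L` has constant rank.

Self-extensions pass between a module and its syzygy where Ext into `R` vanishes
(`subsingleton_ext_self_syzygy_iff`), so (SACC) for `L` gives `Ext^i(N/xN, N/xN) = 0` for `i > 1`.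
As `x` kills `N/xN`, this yields `Ext^i(N, N/xN) = 0` for `i > 0`; Nakayama then gives `Ext^i(N, N)
= 0`, which transfers back to `M`. -/

lemma subsingleton_ext_X₁ (hS : S.ShortExact) (X : C) (n : ℕ)
    (h₃ : Subsingleton (Ext X S.X₃ n)) (h₂ : Subsingleton (Ext X S.X₂ (n + 1))) :
    Subsingleton (Ext X S.X₁ (n + 1)) := by
  refine subsingleton_of_forall_eq 0 fun e ↦ ?_
  obtain ⟨y, rfl⟩ := Ext.covariant_sequence_exact₁ X hS e (Subsingleton.elim _ _) rfl
  rw [Subsingleton.elim y 0, Ext.zero_comp]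

lemma subsingleton_ext_X₃ (hS : S.ShortExact) (X : C) (n : ℕ)
    (h₂ : Subsingleton (Ext X S.X₂ n)) (h₁ : Subsingleton (Ext X S.X₁ (n + 1))) :
    Subsingleton (Ext X S.X₃ n) := by
  refine subsingleton_of_forall_eq 0 fun e ↦ ?_
  obtain ⟨y, rfl⟩ := Ext.covariant_sequence_exact₃ X hS e rfl (Subsingleton.elim _ _)
  rw [Subsingleton.elim y 0, Ext.zero_comp]

lemma subsingleton_ext_of_X₁ (hS : S.ShortExact) (Y : C) (n : ℕ)
    (h₂ : Subsingleton (Ext S.X₂ Y n)) (h₃ : Subsingleton (Ext S.X₃ Y (n + 1))) :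
    Subsingleton (Ext S.X₁ Y n) := by
  refine subsingleton_of_forall_eq 0 fun e ↦ ?_
  obtain ⟨y, rfl⟩ := Ext.contravariant_sequence_exact₁ hS Y e (add_comm 1 n)
    (Subsingleton.elim _ _)
  rw [Subsingleton.elim y 0, Ext.comp_zero]

lemma subsingleton_ext_of_X₃ (hS : S.ShortExact) (Y : C) (n : ℕ)
    (h₁ : Subsingleton (Ext S.X₁ Y n)) (h₂ : Subsingleton (Ext S.X₂ Y (n + 1))) :
    Subsingleton (Ext S.X₃ Y (n + 1)) := by
  refine subsingleton_of_forall_eq 0 fun e ↦ ?_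
  obtain ⟨y, rfl⟩ := Ext.contravariant_sequence_exact₃ hS Y e (Subsingleton.elim _ _)
    (add_comm 1 n)
  rw [Subsingleton.elim y 0, Ext.comp_zero]

/-- Dimension shifting in the first argument along a projective. -/
lemma subsingleton_ext_syzygy (hS : S.ShortExact) [Projective S.X₂] (Y : C) {n : ℕ} (hn : 0 < n)
    (h : Subsingleton (Ext S.X₃ Y (n + 1))) : Subsingleton (Ext S.X₁ Y n) := by
  obtain ⟨n, rfl⟩ := Nat.exists_eq_add_one.2 hn
  exact hS.subsingleton_ext_of_X₁ Y _ (Ext.subsingleton_of_projective _ _ _) h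

/-- If the extension groups of `S.X₃` by the projective `S.X₂` vanish in degrees `n` and `n + 1`,
then the self-extensions of `S.X₃` and of its syzygy `S.X₁` vanish simultaneously. -/
lemma subsingleton_ext_self_syzygy_iff (hS : S.ShortExact) [Projective S.X₂] {n : ℕ} (hn : 0 < n)
    (h : Subsingleton (Ext S.X₃ S.X₂ n)) (h' : Subsingleton (Ext S.X₃ S.X₂ (n + 1))) :
    Subsingleton (Ext S.X₁ S.X₁ n) ↔ Subsingleton (Ext S.X₃ S.X₃ n) :=
  ⟨fun h₁ ↦ hS.subsingleton_ext_X₃ _ _ h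
      (hS.subsingleton_ext_of_X₃ _ _ h₁ (Ext.subsingleton_of_projective _ _ _)),
    fun h₃ ↦ hS.subsingleton_ext_syzygy _ hn (hS.subsingleton_ext_X₁ _ _ h₃ h')⟩

end CategoryTheory.ShortComplex.ShortExact

open Abelian

lemma ModuleCat.subsingleton_ext_pi {R : Type u} [CommRing R] (X : ModuleCat.{u} R) (n i : ℕ)
    (h : Subsingleton (Ext X (ModuleCat.of R R) i)) :
    Subsingleton (Ext X (ModuleCat.of R (Fin n → R)) i) := by
  refine subsingleton_of_forall_eq 0 fun e ↦ ?_
  -- Each summand factors through `R`, where the class of `e` dies.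
  have hid : 𝟙 (ModuleCat.of R (Fin n → R)) = ∑ j : Fin n,
      ModuleCat.ofHom (LinearMap.proj (R := R) (φ := fun _ : Fin n ↦ R) j) ≫
        ModuleCat.ofHom (LinearMap.single R (fun _ : Fin n ↦ R) j) := by
    ext v j
    simp [ModuleCat.hom_sum, Finset.sum_apply, Pi.single_apply]
  rw [← Ext.comp_mk₀_id e, hid, Ext.mk₀_sum, Ext.comp_sum]
  refine Finset.sum_eq_zero fun j _ ↦ ?_
  rw [← Ext.mk₀_comp_mk₀, ← Ext.comp_assoc_of_second_deg_zero,
    Subsingleton.elim (e.comp (Ext.mk₀ _) (add_zero i)) 0, Ext.zero_comp]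

lemma mem_primeCompl_of_mem_associatedPrimes {R : Type u} [CommRing R] {x : R}
    (hx : IsSMulRegular R x) {p : Ideal R} [p.IsPrime] (hp : p ∈ associatedPrimes R R) :
    x ∈ p.primeCompl := by
  intro hxp
  obtain ⟨hprime, y, hy⟩ := hp
  rw [hy] at hxp
  -- `p` is given as the radical of the annihilator of `y`, so only a power of `x` is known to kill
  -- `y`.
  obtain ⟨k, hk⟩ := hxp
  have hk' : x ^ k • y = x ^ k • 0 := by
    simpa [Submodule.mem_colon_singleton] using hk
  obtain rfl := hx.pow k hk'
  exact hprime.ne_top (hy.trans (by simp))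

namespace SymmetricAuslander

/-- A submodule of `R ^ n` that contains `x R ^ n`, for a regular element `x`, has constant
rank `n`. -/
lemma hasConstantRank_of_smul_mem {R : Type u} [CommRing R] {x : R} (hx : IsSMulRegular R x)
    {n : ℕ} (K : Submodule R (Fin n → R)) (hK : ∀ v, x • v ∈ K) : HasConstantRank R K := by
  refine ⟨n, fun p _ hp ↦ ?_⟩
  have hxp := mem_primeCompl_of_mem_associatedPrimes hx hp
  let f : (Fin n → R) →ₗ[R] (Fin n → Localization.AtPrime p) :=
    LinearMap.pi fun i ↦ Algebra.linearMap R (Localization.AtPrime p) ∘ₗ LinearMap.proj i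
  have hf : IsLocalizedModule p.primeCompl f := IsLocalizedModule.pi _ _
  have hg : IsLocalizedModule p.primeCompl (f ∘ₗ K.subtype) :=
    { map_units := hf.map_units
      surj := fun y ↦ by
        obtain ⟨⟨v, s⟩, hv⟩ := hf.surj y
        -- Expanding the fraction `v / s` by `x ∉ p` moves its numerator into `K`.
        refine ⟨⟨⟨x • v, hK v⟩, ⟨x, hxp⟩ * s⟩, ?_⟩
        change (x * (s : R)) • y = f (x • v)
        rw [map_smul, mul_smul]
        exact congrArg (x • ·) hv
      exists_of_eq := fun {a b} hab ↦ by
        obtain ⟨c, hc⟩ := hf.exists_of_eq hab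
        exact ⟨c, Subtype.ext hc⟩ }
  exact ⟨(IsLocalizedModule.iso p.primeCompl (f ∘ₗ K.subtype)).extendScalarsOfIsLocalization
    p.primeCompl (Localization.AtPrime p)⟩

lemma exists_isSMulRegular_of_depth_pos {R : Type u} [CommRing R] [IsLocalRing R]
    (hR : 0 < depth R) : ∃ x ∈ IsLocalRing.maximalIdeal R, IsSMulRegular R x := by
  simp only [depth, lt_iSup_iff] at hR
  obtain ⟨rs, hrs, hm, hlen⟩ := hR
  cases rs with
  | nil => simp at hlen
  | cons x rs =>
    exact ⟨x, hm x (by simp), ((RingTheory.Sequence.isRegular_cons_iff R x rs).1 hrs).1⟩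

/-- Nakayama's lemma for extension groups: if `x ∈ 𝔪` is regular on `N` then `Ext^i(M, N)` vanishes
as soon as `Ext^i(M, N / x N)` does. -/
lemma subsingleton_ext_of_quotSMulTop {R : Type u} [CommRing R] [IsNoetherianRing R]
    [IsLocalRing R] {x : R} (hxm : x ∈ IsLocalRing.maximalIdeal R) (M N : ModuleCat.{u} R)
    [Module.Finite R M] [Module.Finite R N] (hx : IsSMulRegular N x) (i : ℕ)
    (h : Subsingleton (Ext M (N.smulShortComplex x).X₃ i)) : Subsingleton (Ext M N i) := by
  have hS := hx.smulShortComplex_shortExact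
  -- Every class dies in `Ext^i(M, N / xN)`, hence is a multiple of `x`.
  have htop : (⊤ : Submodule R (Ext M N i)) ≤ Ideal.span {x} • ⊤ := by
    intro e _
    obtain ⟨y, hy⟩ := Ext.covariant_sequence_exact₂ M hS (e : Ext M (N.smulShortComplex x).X₂ i)
      (Subsingleton.elim _ _)
    have : x • (y : Ext M N i) = e := by
      rw [Ext.smul_eq_comp_mk₀]; exact hy
    rw [← this]
    exact Submodule.smul_mem_smul (Ideal.mem_span_singleton_self x) trivial
  have hbot := Submodule.eq_bot_of_le_smul_of_le_jacobson_bot (Ideal.span {x}) _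
    (Module.finite_def.1 inferInstance) htop
    (by rwa [IsLocalRing.jacobson_eq_maximalIdeal _ bot_ne_top, Ideal.span_singleton_le_iff_mem])
  exact (Submodule.subsingleton_iff R).1 (subsingleton_of_bot_eq_top hbot.symm)

/-- If `Ext^{i+1}(M / x M, M / x M) = 0` with `x` regular on `M`, then `Ext^i(M, M / x M) = 0`. -/
lemma subsingleton_ext_quotSMulTop {R : Type u} [CommRing R] {x : R} (M : ModuleCat.{u} R)
    (hx : IsSMulRegular M x) (i : ℕ)
    (h : Subsingleton (Ext (M.smulShortComplex x).X₃ (M.smulShortComplex x).X₃ (i + 1))) :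
    Subsingleton (Ext M (M.smulShortComplex x).X₃ i) := by
  have hS := hx.smulShortComplex_shortExact
  refine subsingleton_of_forall_eq 0 fun e ↦ ?_
  -- The obstruction to dividing `e` by `x` lies in the vanishing `Ext^{i+1}`. The quotient `e = x •
  -- y` is then zero, since `x` may equally act through the target, which it kills.
  obtain ⟨y, rfl⟩ := Ext.contravariant_sequence_exact₁ hS _
    (e : Ext (M.smulShortComplex x).X₁ _ i) (add_comm 1 i) (Subsingleton.elim _ _)
  have hann : x ∈ Module.annihilator R (M.smulShortComplex x).X₃ := by
    refine Module.mem_annihilator.2 fun m ↦ ?_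
    obtain ⟨m, rfl⟩ := Submodule.Quotient.mk_surjective _ m
    exact (Submodule.Quotient.mk_eq_zero _).2 (Submodule.smul_mem_pointwise_smul m x ⊤ trivial)
  have h0 : x • 𝟙 (M.smulShortComplex x).X₃ = 0 := by
    ext m
    exact Module.mem_annihilator.1 hann m
  have : (Ext.mk₀ (M.smulShortComplex x).f).comp y (zero_add i) = x • y := by
    have key (z : Ext M (M.smulShortComplex x).X₃ i) :
        (Ext.mk₀ (x • 𝟙 M)).comp z (zero_add i) = x • z := by
      rw [Ext.mk₀_smul, Ext.smul_comp, Ext.mk₀_id_comp]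
    exact key y
  rw [this, Ext.smul_eq_comp_mk₀, h0, Ext.mk₀_zero, Ext.comp_zero]
  rfl

/-- Under (SACC), the conclusion of (SAC) holds for modules with a regular element in the maximal
ideal. -/
lemma extVanishesAbove_of_isSMulRegular {R : Type u} [CommRing R] [IsNoetherianRing R]
    [IsLocalRing R] (hR : SACC R) {x : R} (hxm : x ∈ IsLocalRing.maximalIdeal R)
    (hx : IsSMulRegular R x) (M : Type u) [AddCommGroup M] [Module R M] [Module.Finite R M]
    (hxM : IsSMulRegular M x) (hMR : ExtVanishesAbove R 0 M R)
    (hMM : ∃ n : ℕ, ExtVanishesAbove R n M M) : ExtVanishesAbove R 0 M M := by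
  obtain ⟨a, ha⟩ := hMM
  have hS := IsSMulRegular.smulShortComplex_shortExact (M := ModuleCat.of R M) hxM
  obtain ⟨n, f, hf⟩ := Module.Finite.exists_fin' R (QuotSMulTop x M)
  have hT := LinearMap.shortExact_shortComplexKer hf
  have : Projective f.shortComplexKer.X₂ :=
    ModuleCat.projective_of_free (Pi.basisFun R (Fin n))
  -- Degree 1 is excluded: `Hom(M, R)` contributes to `Ext^1(M / xM, R)`.
  have hQR (i : ℕ) (hi : 1 < i) :
      Subsingleton (Ext (ModuleCat.of R (QuotSMulTop x M)) (ModuleCat.of R R) i) := by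
    obtain ⟨i, rfl⟩ := Nat.exists_eq_add_one.2 (by omega : 0 < i)
    exact hS.subsingleton_ext_of_X₃ _ i (hMR i (by omega)) (hMR (i + 1) (by omega))
  have hQF (i : ℕ) (hi : 1 < i) :
      Subsingleton (Ext f.shortComplexKer.X₃ f.shortComplexKer.X₂ i) :=
    ModuleCat.subsingleton_ext_pi _ n i (hQR i hi)
  have hQQ (i : ℕ) (hi : a + 1 < i) : Subsingleton
      (Ext (ModuleCat.of R (QuotSMulTop x M)) (ModuleCat.of R (QuotSMulTop x M)) i) := by
    have hMQ (j : ℕ) (hj : a < j) :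
        Subsingleton (Ext (ModuleCat.of R M) (ModuleCat.of R (QuotSMulTop x M)) j) :=
      hS.subsingleton_ext_X₃ _ j (ha j hj) (ha (j + 1) (by omega))
    obtain ⟨i, rfl⟩ := Nat.exists_eq_add_one.2 (by omega : 0 < i)
    exact hS.subsingleton_ext_of_X₃ _ i (hMQ i (by omega)) (hMQ (i + 1) (by omega))
  have hrank : HasConstantRank R (LinearMap.ker f) := by
    refine hasConstantRank_of_smul_mem hx _ fun v ↦ ?_
    rw [LinearMap.mem_ker, map_smul]
    obtain ⟨m, hm⟩ := Submodule.Quotient.mk_surjective _ (f v)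
    rw [← hm]
    exact (Submodule.Quotient.mk_eq_zero _).2 (Submodule.smul_mem_pointwise_smul m x ⊤ trivial)
  -- Passing to the syzygy lowers the degree by one, which absorbs the missing degree 1 of `hQR`.
  have hK : ExtVanishesAbove R 0 (LinearMap.ker f) (LinearMap.ker f) :=
    hR _ hrank (fun i hi ↦ hT.subsingleton_ext_syzygy _ hi (hQR _ (by omega)))
      ⟨a + 1, fun i hi ↦ (hT.subsingleton_ext_self_syzygy_iff (by omega) (hQF _ (by omega))
        (hQF _ (by omega))).2 (hQQ i hi)⟩
  intro i hi
  -- The transfer to `M / xM` works only in degrees above 1; degree `i + 1` is all that the descent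
  -- to `Ext^i(M, M / xM)` needs.
  have hQ : Subsingleton (Ext (ModuleCat.of R (QuotSMulTop x M))
      (ModuleCat.of R (QuotSMulTop x M)) (i + 1)) :=
    (hT.subsingleton_ext_self_syzygy_iff (by omega) (hQF _ (by omega)) (hQF _ (by omega))).1
      (hK (i + 1) (by omega))
  exact subsingleton_ext_of_quotSMulTop hxm (ModuleCat.of R M) (ModuleCat.of R M) hxM i
    (subsingleton_ext_quotSMulTop (ModuleCat.of R M) hxM i hQ)

/-- If the maximal ideal contains a regular element, (SACC) implies (SAC). -/
lemma SACC.sac {R : Type u} [CommRing R] [IsNoetherianRing R] [IsLocalRing R]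
    (hR : SACC R) {x : R} (hxm : x ∈ IsLocalRing.maximalIdeal R) (hx : IsSMulRegular R x) :
    SAC R := by
  intro M _ _ _ hMR ⟨a, ha⟩
  obtain ⟨n, f, hf⟩ := Module.Finite.exists_fin' R M
  have hT := LinearMap.shortExact_shortComplexKer hf
  have : Projective f.shortComplexKer.X₂ :=
    ModuleCat.projective_of_free (Pi.basisFun R (Fin n))
  have hMF (i : ℕ) (hi : 0 < i) :
      Subsingleton (Ext f.shortComplexKer.X₃ f.shortComplexKer.X₂ i) :=
    ModuleCat.subsingleton_ext_pi _ n i (hMR i hi)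
  have hiff (i : ℕ) (hi : 0 < i) :=
    hT.subsingleton_ext_self_syzygy_iff hi (hMF i hi) (hMF (i + 1) (by omega))
  have hxK : IsSMulRegular (LinearMap.ker f) x := fun u v huv ↦
    Subtype.ext (funext fun j ↦ hx (congrFun (congrArg Subtype.val huv) j))
  have hK := extVanishesAbove_of_isSMulRegular hR hxm hx (LinearMap.ker f) hxK
    (fun i hi ↦ hT.subsingleton_ext_syzygy _ hi (hMR _ (by omega)))
    ⟨a, fun i hi ↦ (hiff i (by omega)).2 (ha i hi)⟩
  exact fun i hi ↦ (hiff i hi).1 (hK i hi)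

end SymmetricAuslander

theorem corollary2p5 (R : Type u) [CommRing R] [IsNoetherianRing R] [IsLocalRing R]
    (hR : 0 < SymmetricAuslander.depth R) :
    SymmetricAuslander.SAC R ↔ SymmetricAuslander.SACC R := by
  obtain ⟨x, hxm, hx⟩ := SymmetricAuslander.exists_isSMulRegular_of_depth_pos hR
  exact ⟨fun h M _ _ _ _ ↦ h M, fun h ↦ h.sac hxm hx⟩
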